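/- Let $G=(\mathcal V,\mathcal E)$ be a finite connected undirected graph with at least two nodes, in which self-loops are allowed and edges are simple ($\mathcal E\subset\mathcal V\times\mathcal V$ symmetric); write $\mathcal E(i)$ for the set of neighbors of $i$. A family of weights is $\alpha=(\alpha_{i,j})_{(i,j)\in\mathcal E}$ with $\alpha_{i,j}=\alpha_{j,i}>0$; put $\mu^\alpha(i)=\sum_{j\in\mathcal E(i)}\alpha_{i,j}$ and $\bar\mu^\alpha(i)=\mu^\alpha(i)/\sum_{l\in\mathcal V}\mu^\alpha(l)$. In the matching model $(G,\Phi,\bar\mu)$, items arrive one by one, with i.i.d. classes of law $\bar\mu$, a probability measure of full support on $\mathcal V$. If the buffer holds an item whose class is a neighbor of the class of the incoming item, the incoming item is matched with one such item, chosen by the policy $\Phi$, and both leave at once; otherwise the incoming item is stored. The policy $\Phi$ is admissible: the choice depends only on the class of the incoming item, on the classes and arrival dates of the stored items (dates being measured relative to the present), and possibly on a random draw independent of everything else. Let $W^{\Phi,\bar\mu}$ be the resulting Markov chain, started from the empty buffer, whose state is the word of the stored items in order of arrival, each recorded with its class and its age, on the set of states reachable from the empty buffer. Let $\textsc{stab}(G,\Phi)$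 be the set of probability measures $\bar\mu$ of full support on $\mathcal V$ for which $W^{\Phi,\bar\mu}$ is positive recurrent. Then $$\textsc{stab}(G,\Phi)\subset\{\bar\mu^\alpha:\alpha\text{ a family of weights on }\mathcal E\}=\mathcal W^1(G),$$ where $\mathcal W^1(G)$ is the set of probability measures of the form $\mu^\alpha$, $\alpha$ a family of weights. Specifically, if $\bar\mu\in\textsc{stab}(G,\Phi)$, then the chain has a unique stationary distribution $\Pi$ and, with $\Pi(A_{i\to j})$ the probability that, the buffer having law $\Pi$, an incoming $i$-item is matched with a stored $j$-item, and $$\Theta[i,j]=\bar\mu(i)\,\Pi(A_{i\to j})+\bar\mu(j)\,\Pi(A_{j\to i})\,\mathbf 1_{\{i\ne j\}},$$ the family $\alpha_{i,j}=(1+\mathbf 1_{\{i=j\}})\,\Theta[i,j]$, $(i,j)\in\mathcal E$, is a family of weights (symmetric, and positive on every edge), and $\bar\mu=\bar\mu^{\alpha}$. -/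

import Mathlib

open scoped ENNReal

/-- An undirected graph on the node set `V`, self-loops allowed, edges simple:
a symmetric subset of `V × V`. -/
structure Multigraph (V : Type*) where
  Adj : V → V → Prop
  symm : ∀ {u v : V}, Adj u v → Adj v u

namespace Multigraph

variable {V : Type*}

/-- Any two nodes are joined by a path. -/
def Connected (G : Multigraph V) : Prop :=
  ∀ u v : V, Relation.ReflTransGen G.Adj u v

/-- A family of weights on the edges: symmetric and positive on every edge
(the values of `α` outside the edge set are never used). -/
def IsWeights (G : Multigraph V) (α : V → V → ℝ) : Prop :=
  ∀ i j : V, G.Adj i j → α i j = α j i ∧ 0 < α i j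

open Classical in
/-- The weighted measure `μ^α`: `μ^α(i)` is the sum of `α i j` over the neighbors `j` of `i`. -/
noncomputable def weightedMeasure [Fintype V] (G : Multigraph V) (α : V → V → ℝ) (i : V) : ℝ :=
  ∑ j : V with G.Adj i j, α i j

/-- The normalized weighted measure. -/
noncomputable def normWeightedMeasure [Fintype V] (G : Multigraph V) (α : V → V → ℝ)
    (i : V) : ℝ :=
  G.weightedMeasure α i / ∑ l : V, G.weightedMeasure α l

/-- The set of probability measures on the nodes that are normalized weighted measures. -/
def weightedProbabilities [Fintype V] (G : Multigraph V) : Set (PMF V) :=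
  {μ | ∃ α : V → V → ℝ, G.IsWeights α ∧ ∀ i : V, (μ i).toReal = G.normWeightedMeasure α i}

/-- The set of probability measures on the nodes that are (unnormalized) weighted measures. -/
def unitWeightedMeasures [Fintype V] (G : Multigraph V) : Set (PMF V) :=
  {μ | ∃ α : V → V → ℝ, G.IsWeights α ∧ ∀ i : V, (μ i).toReal = G.weightedMeasure α i}

end Multigraph

/-! ### Markov chains on a discrete state space, given by a transition kernel `P` -/

namespace DiscreteChain

variable {S : Type*}

/-- `y` can be reached from `x` with positive probability. -/
def Reaches (P : S → PMF S) (x y : S) : Prop :=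
  Relation.ReflTransGen (fun a b => b ∈ (P a).support) x y

open Classical in
/-- `avoidProb P x n y` is the probability that the chain started at `y` is different
from `x` at each of the times `1, …, n`. -/
noncomputable def avoidProb (P : S → PMF S) (x : S) : ℕ → S → ℝ≥0∞
  | 0, _ => 1
  | n + 1, y => ∑' z : S, if z = x then 0 else P y z * avoidProb P x n z

/-- The mean return time `E_x[T_x] = ∑_{n ≥ 0} P_x(T_x > n)`, where `T_x ≥ 1` is the first
return time to `x`. -/
noncomputable def meanReturnTime (P : S → PMF S) (x : S) : ℝ≥0∞ :=
  ∑' n : ℕ, avoidProb P x n x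

/-- The chain started at `o`, whose state space is the set of states that can be reached
from `o`, is positive recurrent: all its states have a finite mean return time. -/
def PositiveRecurrentFrom (P : S → PMF S) (o : S) : Prop :=
  ∀ x : S, Reaches P o x → meanReturnTime P x < ∞

/-- The probability distribution `π` is stationary. -/
def IsStationary (P : S → PMF S) (π : PMF S) : Prop :=
  π.bind P = π

end DiscreteChain

/-! ### The general stochastic matching model -/

/-- The content of the buffer: the word of the stored items, in order of arrival (oldest first).
An item is recorded by its class and its age, that is, the number of arrivals since its own
(so the age encodes the arrival date, seen from the present). -/
abbrev Buffer (V : Type*) := List (V × ℕ)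

/-- Some stored item is compatible with an incoming item of class `i`. -/
def HasMatch {V : Type*} (G : Multigraph V) (w : Buffer V) (i : V) : Prop :=
  ∃ x ∈ w, G.Adj i x.1

/-- An admissible matching policy. When the buffer is `w` and an item of class `i` arrives that
is compatible with some stored item, it is matched with the item at a position of `w` drawn, from
fresh randomness, according to the law `pick w i`, which is carried by the compatible items.
(The value of `pick w i` is not used if no stored item is compatible.) -/
structure AdmissiblePolicy {V : Type*} (G : Multigraph V) where
  pick : Buffer V → V → PMF ℕ
  compatible : ∀ (w : Buffer V) (i : V), HasMatch G w i →
    ∀ k ∈ (pick w i).support, ∃ x : V × ℕ, w[k]? = some x ∧ G.Adj i x.1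

namespace AdmissiblePolicy

variable {V : Type*} {G : Multigraph V}

/-- All stored items get older by one time unit. -/
def grow (w : Buffer V) : Buffer V :=
  w.map fun x => (x.1, x.2 + 1)

open Classical in
/-- The transition kernel of the chain of buffers when the classes of the incoming items
are independent with law `μ`: the incoming item is matched whenever this is possible, the two
matched items leave, and otherwise the incoming item is stored. -/
noncomputable def step (Φ : AdmissiblePolicy G) (μ : PMF V) (w : Buffer V) : PMF (Buffer V) :=
  μ.bind fun i =>
    if HasMatch G w i then (Φ.pick w i).map fun k => grow (w.eraseIdx k)
    else PMF.pure (grow w ++ [(i, 0)])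

/-- The stability region: the probability measures of full support for which the chain of
buffers is positive recurrent. -/
def stab (Φ : AdmissiblePolicy G) : Set (PMF V) :=
  {μ | (∀ i : V, i ∈ μ.support) ∧ DiscreteChain.PositiveRecurrentFrom (Φ.step μ) []}

open Classical in
/-- The class of the stored item that gets matched with an `i`-item arriving at the buffer `w`
(`none` if the incoming item is not matched). -/
noncomputable def matchedClass (Φ : AdmissiblePolicy G) (w : Buffer V) (i : V) :
    PMF (Option V) :=
  if HasMatch G w i then (Φ.pick w i).map fun k => w[k]?.map Prod.fst
  else PMF.pure none

/-- The probability `π(A_{i→j})` that, in a buffer of law `π`, an incoming `i`-item gets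
matched with a stored `j`-item. -/
noncomputable def matchProb (Φ : AdmissiblePolicy G) (π : PMF (Buffer V)) (i j : V) : ℝ :=
  ((π.bind fun w => Φ.matchedClass w i) (some j)).toReal

open Classical in
/-- The asymptotic matching rate of `i` with `j`, for the arrival law `μ` and the stationary
distribution `π`. -/
noncomputable def matchingRate (Φ : AdmissiblePolicy G) (μ : PMF V) (π : PMF (Buffer V))
    (i j : V) : ℝ :=
  (μ i).toReal * Φ.matchProb π i j +
    (μ j).toReal * Φ.matchProb π j i * (if i ≠ j then 1 else 0)

open Classical in
/-- The weights given by the matching rates. -/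
noncomputable def rateWeights (Φ : AdmissiblePolicy G) (μ : PMF V) (π : PMF (Buffer V))
    (i j : V) : ℝ :=
  (1 + if i = j then 1 else 0) * Φ.matchingRate μ π i j

end AdmissiblePolicy

/-! ### Expectations under a discrete law -/

namespace PMF

variable {A B : Type*}

/-! The theorem is a conservation law. In the stationary regime the number of stored `i`-items rises
as often as it falls, so μ(i) Π(an `i`-arrival is unmatched) = ∑ⱼ μ(j) Π(A_{j→i})
(`mul_bind_matchedClass_none`). Adding μ(i) ∑ⱼ Π(A_{i→j}), the matched arrivals, gives μ(i) = ∑ⱼ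
(μ(i) Π(A_{i→j}) + μ(j) Π(A_{j→i})). The summands are the weights α; they vanish off the edges, so μ
= μ^α, which already has mass one.

The stored count may have infinite mean, so expectations cannot be subtracted. `drift_eq` instead
balances the flux across each level of the count.

The law Π is the normalized mean occupation of an excursion from the empty buffer, so it charges
that buffer. It is unique because every buffer can be emptied. Weights are positive because Π also
charges the buffer holding a single `j`-item, where an arriving neighbor has no other partner. -/

theorem tsum_bind_mul (p : PMF A) (q : A → PMF B) (f : B → ℝ≥0∞) :
    ∑' b, p.bind q b * f b = ∑' a, p a * ∑' b, q a b * f b := by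
  simp only [PMF.bind_apply, ← ENNReal.tsum_mul_right, ← ENNReal.tsum_mul_left, mul_assoc]
  exact ENNReal.tsum_comm

theorem tsum_pure_mul (a : A) (f : A → ℝ≥0∞) : ∑' b, PMF.pure a b * f b = f a := by
  rw [tsum_eq_single a]
  · simp
  · intro b hb
    simp [PMF.pure_apply, hb]

theorem tsum_map_mul (p : PMF A) (h : A → B) (f : B → ℝ≥0∞) :
    ∑' b, p.map h b * f b = ∑' a, p a * f (h a) := by
  rw [PMF.map, tsum_bind_mul]
  simp only [Function.comp_apply, tsum_pure_mul]

theorem tsum_mul_le (p : PMF A) {f : A → ℝ≥0∞} {c : ℝ≥0∞} (hf : ∀ a, f a ≤ c) :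
    ∑' a, p a * f a ≤ c :=
  calc ∑' a, p a * f a ≤ ∑' a, p a * c := ENNReal.tsum_le_tsum fun a => by gcongr; exact hf a
    _ = c := by rw [ENNReal.tsum_mul_right, p.tsum_coe, one_mul]

theorem sum_toReal [Fintype A] (μ : PMF A) : ∑ i, (μ i).toReal = 1 := by
  rw [← ENNReal.toReal_sum fun i _ => μ.apply_ne_top i, ← tsum_fintype (L := .unconditional A),
    μ.tsum_coe, ENNReal.toReal_one]

end PMF

/-! ### Stationary distributions -/

namespace DiscreteChain

variable {S : Type*} (P : S → PMF S)

open Classical in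
/-- `tabooMass P x n y` is the probability that the chain started at `x` is at `y` at time `n`
without having come back to `x` at the times `1, …, n`. -/
noncomputable def tabooMass (x : S) : ℕ → S → ℝ≥0∞
  | 0, y => if y = x then 1 else 0
  | n + 1, y => if y = x then 0 else ∑' z : S, tabooMass x n z * P z y

/-- The mean number of visits to `y` during an excursion away from `x`. -/
noncomputable def excursionMass (x y : S) : ℝ≥0∞ :=
  ∑' n : ℕ, tabooMass P x n y

/-- Markov property at time `n`. `tabooMass` unfolds at its last step and `avoidProb` at its first,
so induction moves one step from one factor to the other. -/
theorem tsum_tabooMass_mul_avoidProb (x : S) (m : ℕ) :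
    ∀ n : ℕ, ∑' y, tabooMass P x n y * avoidProb P x m y = avoidProb P x (n + m) x := by
  intro n
  induction n generalizing m with
  | zero =>
    rw [tsum_eq_single x]
    · simp [tabooMass]
    · intro y hy
      simp [tabooMass, hy]
  | succ n ih =>
    rw [show n + 1 + m = n + (m + 1) by ring, ← ih (m + 1)]
    simp only [tabooMass, avoidProb, ← ENNReal.tsum_mul_left]
    rw [ENNReal.tsum_comm]
    refine tsum_congr fun z => ?_
    by_cases hz : z = x
    · simp [hz]
    · simp only [hz, if_false, ← ENNReal.tsum_mul_right, mul_assoc]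

theorem tsum_tabooMass (x : S) (n : ℕ) : ∑' y, tabooMass P x n y = avoidProb P x n x := by
  simpa [avoidProb] using tsum_tabooMass_mul_avoidProb P x 0 n

theorem tsum_excursionMass (x : S) : ∑' y, excursionMass P x y = meanReturnTime P x := by
  simp only [excursionMass, meanReturnTime]
  rw [ENNReal.tsum_comm]
  exact tsum_congr fun n => tsum_tabooMass P x n

theorem excursionMass_self (x : S) : excursionMass P x x = 1 := by
  rw [excursionMass, tsum_eq_zero_add' ENNReal.summable]
  simp [tabooMass]

theorem tsum_excursionMass_mul_of_ne {x y : S} (h : y ≠ x) :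
    ∑' z, excursionMass P x z * P z y = excursionMass P x y := by
  simp only [excursionMass, ← ENNReal.tsum_mul_right]
  rw [ENNReal.tsum_comm, tsum_eq_zero_add' (f := fun n => tabooMass P x n y) ENNReal.summable]
  simp [tabooMass, h]

/-- Off `x`, invariance is a shift of time. At `x` it follows by conservation of total mass: `P`
preserves the sum, all other terms agree, and finiteness of the sum allows cancelling them. -/
theorem tsum_excursionMass_mul {x : S} (hx : meanReturnTime P x < ∞) (y : S) :
    ∑' z, excursionMass P x z * P z y = excursionMass P x y := by
  classical
  by_cases hy : y = x
  swap
  · exact tsum_excursionMass_mul_of_ne P hy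
  subst hy
  have h1 : ∑' y', ∑' z, excursionMass P y z * P z y' = meanReturnTime P y := by
    rw [ENNReal.tsum_comm, ← tsum_excursionMass]
    exact tsum_congr fun z => by rw [ENNReal.tsum_mul_left, (P z).tsum_coe, mul_one]
  have h2 := tsum_excursionMass P y
  rw [ENNReal.tsum_eq_add_tsum_ite y] at h1 h2
  have h3 : (∑' y', if y' = y then 0 else ∑' z, excursionMass P y z * P z y') =
      ∑' y', if y' = y then 0 else excursionMass P y y' :=
    tsum_congr fun y' => by
      split_ifs with h
      · rfl
      · exact tsum_excursionMass_mul_of_ne P h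
  rw [h3, ← h2] at h1
  refine (ENNReal.add_left_inj ?_).1 h1
  exact ne_top_of_le_ne_top hx.ne (h2 ▸ le_add_self)

theorem one_le_meanReturnTime (x : S) : 1 ≤ meanReturnTime P x := by
  rw [← tsum_excursionMass, ← excursionMass_self P x]
  exact ENNReal.le_tsum x

variable {P}

theorem IsStationary.tsum_mul {π : PMF S} (h : IsStationary P π) (y : S) :
    ∑' z, π z * P z y = π y := by
  rw [← PMF.bind_apply, h]

theorem exists_isStationary {x : S} (hx : meanReturnTime P x < ∞) :
    ∃ π : PMF S, IsStationary P π ∧ π x ≠ 0 := by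
  have h0 : meanReturnTime P x ≠ 0 := (one_pos.trans_le (one_le_meanReturnTime P x)).ne'
  have hsum := tsum_excursionMass P x
  obtain ⟨π, hπ⟩ : ∃ π : PMF S, ∀ y, π y = excursionMass P x y * (meanReturnTime P x)⁻¹ :=
    ⟨PMF.normalize (excursionMass P x) (hsum ▸ h0) (hsum ▸ hx.ne),
      fun y => by rw [PMF.normalize_apply, hsum]⟩
  refine ⟨π, PMF.ext fun y => ?_, ?_⟩
  · simp only [PMF.bind_apply, hπ, mul_right_comm _ (meanReturnTime P x)⁻¹,
      ENNReal.tsum_mul_right, tsum_excursionMass_mul P hx]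
  · simpa [hπ, excursionMass_self] using hx.ne

/-- Decomposition at the last visit to `x`: the paths that left `x` fewer than `N` steps ago carry
only part of the mass at `y`. -/
theorem IsStationary.mul_excursionMass_le {π : PMF S} (h : IsStationary P π) (x y : S) :
    π x * excursionMass P x y ≤ π y := by
  have key : ∀ (N : ℕ) (y : S), π x * ∑ n ∈ Finset.range N, tabooMass P x n y ≤ π y := by
    intro N
    induction N with
    | zero => simp
    | succ N ih =>
      intro y
      rw [Finset.sum_range_succ']
      by_cases hy : y = x
      · simp [tabooMass, hy]
      · simp only [tabooMass, hy, if_false, add_zero]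
        rw [← h.tsum_mul y, ← Summable.tsum_finsetSum fun _ _ => ENNReal.summable,
          ← ENNReal.tsum_mul_left]
        refine ENNReal.tsum_le_tsum fun z => ?_
        rw [← Finset.sum_mul, ← mul_assoc]
        gcongr
        exact ih z
  rw [excursionMass, ENNReal.tsum_eq_iSup_nat, ENNReal.mul_iSup]
  exact iSup_le fun N => key N y

/-- The excess of `π` over `π x * excursionMass P x` is nonnegative, invariant and zero at `x`. A
positive excess at `a` would flow along the path from `a` to `x`. -/
theorem IsStationary.mul_excursionMass_eq {π : PMF S} (h : IsStationary P π) {x : S}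
    (hx : meanReturnTime P x < ∞) {y : S} (hy : Reaches P y x) :
    π x * excursionMass P x y = π y := by
  induction hy using Relation.ReflTransGen.head_induction_on with
  | refl => rw [excursionMass_self, mul_one]
  | @head a b hab _ ih =>
    by_contra hne
    have hlt : π x * excursionMass P x a < π a := lt_of_le_of_ne (h.mul_excursionMass_le x a) hne
    have hsum : ∑' z, π x * excursionMass P x z * P z b = π b := by
      simp only [mul_assoc, ENNReal.tsum_mul_left, tsum_excursionMass_mul P hx, ih]
    have := ENNReal.tsum_lt_tsum (i := a) (f := fun z => π x * excursionMass P x z * P z b)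
      (g := fun z => π z * P z b) (hsum ▸ π.apply_ne_top b)
      (fun z => by gcongr; exact h.mul_excursionMass_le x z)
      ((ENNReal.mul_lt_mul_iff_left ((PMF.mem_support_iff _ _).1 hab)
        ((P a).apply_ne_top b)).2 hlt)
    rw [hsum, h.tsum_mul] at this
    exact this.false

/-- Both laws are multiples of the excursion mass, and total mass one fixes the factor. -/
theorem IsStationary.unique {π π' : PMF S} (h : IsStationary P π) (h' : IsStationary P π') {x : S}
    (hx : meanReturnTime P x < ∞) (hr : ∀ y, Reaches P y x) : π' = π := by
  have key : ∀ ρ : PMF S, IsStationary P ρ → ρ x = (meanReturnTime P x)⁻¹ := fun ρ hρ => by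
    refine ENNReal.eq_inv_of_mul_eq_one_left ?_
    rw [← tsum_excursionMass, ← ENNReal.tsum_mul_left, ← ρ.tsum_coe]
    exact tsum_congr fun y => hρ.mul_excursionMass_eq hx (hr y)
  refine PMF.ext fun y => ?_
  rw [← h.mul_excursionMass_eq hx (hr y), ← h'.mul_excursionMass_eq hx (hr y), key _ h, key _ h']

theorem IsStationary.apply_ne_zero {π : PMF S} (h : IsStationary P π) {a b : S} (ha : π a ≠ 0)
    (hab : P a b ≠ 0) : π b ≠ 0 := by
  rw [← h.tsum_mul b]
  exact fun h0 => mul_ne_zero ha hab (ENNReal.tsum_eq_zero.1 h0 a)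

open Classical in
/-- In the stationary regime, the set `A` is left as often as it is entered. -/
theorem IsStationary.flux_eq {π : PMF S} (h : IsStationary P π) (A : Set S) :
    (∑' a, π a * ∑' b, P a b * (if a ∈ A ∧ b ∉ A then 1 else 0)) =
      ∑' a, π a * ∑' b, P a b * (if a ∉ A ∧ b ∈ A then 1 else 0) := by
  -- Exits plus internal moves sum to the mass of `A` by conditioning on the starting point; entries
  -- plus internal moves do so by stationarity. The internal flux is at most one, hence cancels.
  have h1 : (∑' a, π a * ∑' b, P a b * (if a ∈ A ∧ b ∉ A then 1 else 0)) +
      (∑' a, π a * ∑' b, P a b * (if a ∈ A ∧ b ∈ A then 1 else 0)) =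
      ∑' a, π a * (if a ∈ A then 1 else 0) := by
    rw [← ENNReal.tsum_add]
    refine tsum_congr fun a => ?_
    rw [← mul_add, ← ENNReal.tsum_add]
    congr 1
    by_cases ha : a ∈ A
    · rw [if_pos ha, ← (P a).tsum_coe]
      refine tsum_congr fun b => ?_
      by_cases hb : b ∈ A <;> simp [ha, hb]
    · simp [ha]
  have h2 : (∑' a, π a * ∑' b, P a b * (if a ∉ A ∧ b ∈ A then 1 else 0)) +
      (∑' a, π a * ∑' b, P a b * (if a ∈ A ∧ b ∈ A then 1 else 0)) =
      ∑' a, π a * (if a ∈ A then 1 else 0) := by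
    conv_rhs => rw [← h]
    rw [PMF.tsum_bind_mul, ← ENNReal.tsum_add]
    refine tsum_congr fun a => ?_
    rw [← mul_add, ← ENNReal.tsum_add]
    congr 1
    refine tsum_congr fun b => ?_
    by_cases ha : a ∈ A <;> by_cases hb : b ∈ A <;> simp [ha, hb]
  refine (ENNReal.add_left_inj (ne_top_of_le_ne_top ENNReal.one_ne_top ?_)).1 (h1.trans h2.symm)
  exact π.tsum_mul_le fun a => (P a).tsum_mul_le fun b => by split_ifs <;> simp

/-- Layer-cake form of the truncated difference: it counts the levels crossed upwards from `n` to
`m`, and is zero when `m ≤ n`. -/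
theorem natCast_sub_eq_tsum (m n : ℕ) :
    ((m - n : ℕ) : ℝ≥0∞) = ∑' k : ℕ, if n ≤ k ∧ k < m then 1 else 0 := by
  have : ∀ k : ℕ, (if n ≤ k ∧ k < m then (1 : ℝ≥0∞) else 0) =
      if k ∈ Finset.Ico n m then 1 else 0 := fun k => by simp
  simp only [this]
  rw [tsum_eq_sum (s := Finset.Ico n m) fun k hk => if_neg hk, Finset.sum_ite_mem,
    Finset.inter_self, Finset.sum_const, Nat.card_Ico, nsmul_eq_mul, mul_one]

/-- In the stationary regime, the mean increase and the mean decrease of an integer-valued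
function of the state are equal. -/
theorem IsStationary.drift_eq {π : PMF S} (h : IsStationary P π) (f : S → ℕ) :
    (∑' a, π a * ∑' b, P a b * ((f b - f a : ℕ) : ℝ≥0∞)) =
      ∑' a, π a * ∑' b, P a b * ((f a - f b : ℕ) : ℝ≥0∞) := by
  classical
  have swap : ∀ t : ℕ → S → S → ℝ≥0∞, (∑' a, π a * ∑' b, P a b * ∑' k, t k a b) =
      ∑' k, ∑' a, π a * ∑' b, P a b * t k a b := fun t => by
    rw [ENNReal.tsum_comm]
    refine tsum_congr fun a => ?_
    rw [ENNReal.tsum_mul_left, ENNReal.tsum_comm]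
    simp only [ENNReal.tsum_mul_left]
  simp only [natCast_sub_eq_tsum, swap]
  refine tsum_congr fun k => ?_
  -- An upward crossing of level `k` leaves this sublevel set, a downward one enters it.
  have := h.flux_eq {a | f a ≤ k}
  simp only [Set.mem_ofPred_eq, not_le] at this
  rw [this]
  simp only [and_comm]

end DiscreteChain

/-! ### Weights -/

namespace Multigraph

variable {V : Type*} {G : Multigraph V}

theorem Connected.exists_adj [Nontrivial V] (hG : G.Connected) (v : V) : ∃ u, G.Adj u v := by
  obtain ⟨u, hu⟩ := exists_ne v
  rcases Relation.ReflTransGen.cases_head (hG v u) with h | ⟨w, hw, -⟩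
  · exact absurd h.symm hu
  · exact ⟨w, G.symm hw⟩

variable [Fintype V]

theorem weightedMeasure_div (α : V → V → ℝ) (c : ℝ) (i : V) :
    G.weightedMeasure (fun i j => α i j / c) i = G.weightedMeasure α i / c := by
  simp only [weightedMeasure, Finset.sum_div]

theorem normWeightedMeasure_eq_of_forall_eq {μ : PMF V} {α : V → V → ℝ}
    (h : ∀ i, (μ i).toReal = G.weightedMeasure α i) (i : V) :
    (μ i).toReal = G.normWeightedMeasure α i := by
  rw [normWeightedMeasure, ← h, Finset.sum_congr rfl fun l _ => (h l).symm, μ.sum_toReal, div_one]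

theorem weightedProbabilities_eq_unitWeightedMeasures (G : Multigraph V) :
    G.weightedProbabilities = G.unitWeightedMeasures := by
  ext μ
  constructor
  · rintro ⟨α, hα, h⟩
    have h0 : ∀ i, 0 ≤ G.weightedMeasure α i := fun i =>
      Finset.sum_nonneg fun j hj => (hα i j (by simpa using hj)).2.le
    have hpos : 0 < ∑ l, G.weightedMeasure α l := by
      refine lt_of_le_of_ne (Finset.sum_nonneg fun l _ => h0 l) fun h1 => ?_
      -- If the total weight were zero, division by zero would make every `μ i` zero.
      have := μ.sum_toReal
      simp [h, normWeightedMeasure, ← h1] at this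
    refine ⟨fun i j => α i j / ∑ l, G.weightedMeasure α l, fun i j hij => ⟨?_, ?_⟩, fun i => ?_⟩
    · simp only [(hα i j hij).1]
    · exact div_pos (hα i j hij).2 hpos
    · rw [h, weightedMeasure_div, normWeightedMeasure]
  · rintro ⟨α, hα, h⟩
    exact ⟨α, hα, normWeightedMeasure_eq_of_forall_eq h⟩

end Multigraph

/-! ### The matching rates -/

namespace AdmissiblePolicy

variable {V : Type*} {G : Multigraph V} (Φ : AdmissiblePolicy G)

open Classical in
/-- The number of stored items of class `i`. -/
noncomputable def classCount (i : V) (w : Buffer V) : ℕ :=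
  (w.map Prod.fst).count i

open Classical in
/-- The law of the buffer after the arrival of an item of class `i`. -/
noncomputable def arrive (w : Buffer V) (i : V) : PMF (Buffer V) :=
  if HasMatch G w i then (Φ.pick w i).map fun k => grow (w.eraseIdx k)
  else PMF.pure (grow w ++ [(i, 0)])

theorem step_eq_bind (μ : PMF V) (w : Buffer V) : Φ.step μ w = μ.bind (Φ.arrive w) := rfl

theorem classCount_grow (i : V) (w : Buffer V) : classCount i (grow w) = classCount i w := by
  simp [classCount, grow, Function.comp_def]

open Classical in
theorem classCount_append (i j : V) (w : Buffer V) :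
    classCount i (grow w ++ [(j, 0)]) = classCount i w + if j = i then 1 else 0 := by
  rw [← classCount_grow i w]
  simp [classCount, List.count_singleton]

open Classical in
theorem classCount_eraseIdx (i : V) {w : Buffer V} {k : ℕ} {x : V × ℕ} (h : w[k]? = some x) :
    classCount i w = classCount i (w.eraseIdx k) + if x.1 = i then 1 else 0 := by
  induction w generalizing k with
  | nil => simp at h
  | cons y w ih =>
    cases k with
    | zero =>
      obtain rfl : y = x := by simpa using h
      simp [classCount, List.count_cons]
    | succ k =>
      have := ih (k := k) (by simpa using h)
      simp only [classCount, List.eraseIdx_cons_succ, List.map_cons, List.count_cons] at this ⊢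
      omega

open Classical in
-- The count of `i` can rise only when the incoming item has class `i` and is stored, and then by
-- exactly one.
theorem tsum_arrive_increase (w : Buffer V) (i j : V) :
    ∑' w', Φ.arrive w j w' * ((classCount i w' - classCount i w : ℕ) : ℝ≥0∞) =
      if j = i then Φ.matchedClass w j none else 0 := by
  by_cases h : HasMatch G w j
  · rw [arrive, matchedClass, if_pos h, if_pos h, PMF.tsum_map_mul]
    have h1 : ((Φ.pick w j).map fun k => w[k]?.map Prod.fst) none = 0 := by
      rw [PMF.apply_eq_zero_iff, PMF.mem_support_map_iff]
      rintro ⟨k, hk, hkn⟩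
      obtain ⟨x, hx, -⟩ := Φ.compatible w j h k hk
      simp [hx] at hkn
    rw [h1, ite_self]
    refine ENNReal.tsum_eq_zero.2 fun k => ?_
    by_cases hk : k ∈ (Φ.pick w j).support
    · obtain ⟨x, hx, -⟩ := Φ.compatible w j h k hk
      rw [classCount_grow, classCount_eraseIdx i hx]
      simp
    · rw [(PMF.apply_eq_zero_iff _ _).2 hk, zero_mul]
  · rw [arrive, matchedClass, if_neg h, if_neg h, PMF.tsum_pure_mul, classCount_append]
    simp

/-- The count of `i` can fall only when the item removed by a match has class `i`, and then by
exactly one. -/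
theorem tsum_arrive_decrease (w : Buffer V) (i j : V) :
    ∑' w', Φ.arrive w j w' * ((classCount i w - classCount i w' : ℕ) : ℝ≥0∞) =
      Φ.matchedClass w j (some i) := by
  classical
  by_cases h : HasMatch G w j
  · rw [arrive, matchedClass, if_pos h, if_pos h, PMF.tsum_map_mul, PMF.map_apply]
    refine tsum_congr fun k => ?_
    by_cases hk : k ∈ (Φ.pick w j).support
    · obtain ⟨x, hx, -⟩ := Φ.compatible w j h k hk
      rw [classCount_grow, classCount_eraseIdx i hx, hx]
      by_cases hxi : x.1 = i
      · simp [hxi]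
      · simp [hxi, Ne.symm hxi]
    · simp [(PMF.apply_eq_zero_iff _ _).2 hk]
  · rw [arrive, matchedClass, if_neg h, if_neg h, PMF.tsum_pure_mul, classCount_append]
    simp

/-- The items of class `i` are stored at the same rate as the stored items of class `i`
get matched. -/
theorem mul_bind_matchedClass_none {μ : PMF V} {π : PMF (Buffer V)}
    (h : DiscreteChain.IsStationary (Φ.step μ) π) (i : V) :
    μ i * (π.bind fun w => Φ.matchedClass w i) none =
      ∑' j, μ j * (π.bind fun w => Φ.matchedClass w j) (some i) := by
  classical
  have hd := h.drift_eq (classCount i)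
  simp only [step_eq_bind, PMF.tsum_bind_mul, tsum_arrive_increase, tsum_arrive_decrease] at hd
  simp only [PMF.bind_apply, ← ENNReal.tsum_mul_left] at hd ⊢
  rw [ENNReal.tsum_comm]
  refine Eq.trans (tsum_congr fun w => ?_) (hd.trans (tsum_congr fun w => tsum_congr fun j => ?_))
  · rw [tsum_eq_single i fun j hj => by simp [hj]]
    simp [mul_left_comm]
  · rw [mul_left_comm]

theorem step_support_of_hasMatch {μ : PMF V} {w : Buffer V} {i : V} (hi : i ∈ μ.support)
    (h : HasMatch G w i) : ∃ w' ∈ (Φ.step μ w).support, w'.length + 1 = w.length := by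
  obtain ⟨k, hk⟩ := (Φ.pick w i).support_nonempty
  obtain ⟨x, hx, -⟩ := Φ.compatible w i h k hk
  refine ⟨grow (w.eraseIdx k), ?_, ?_⟩
  · rw [step_eq_bind, PMF.mem_support_bind_iff]
    refine ⟨i, hi, ?_⟩
    rw [arrive, if_pos h, PMF.mem_support_map_iff]
    exact ⟨k, hk, rfl⟩
  · obtain ⟨hlt, -⟩ := List.getElem?_eq_some_iff.1 hx
    simp only [grow, List.length_map, List.length_eraseIdx, hlt, if_true]
    omega

/-- The class of the oldest item has a neighbor, which arrives with positive probability and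
shortens the word by one. This also covers words that are not reachable from the empty buffer, so
uniqueness holds among laws on all words. -/
theorem reaches_nil [Nontrivial V] (hG : G.Connected) {μ : PMF V} (hμ : ∀ i, i ∈ μ.support)
    (w : Buffer V) : DiscreteChain.Reaches (Φ.step μ) w [] := by
  induction hn : w.length generalizing w with
  | zero =>
    rw [List.length_eq_zero_iff.1 hn]
    exact Relation.ReflTransGen.refl
  | succ n ih =>
    obtain ⟨x, w₁, rfl⟩ := List.exists_cons_of_length_eq_add_one hn
    obtain ⟨i, hi⟩ := hG.exists_adj x.1
    obtain ⟨w', hw', hlen⟩ := Φ.step_support_of_hasMatch (hμ i)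
      (⟨x, List.mem_cons_self, hi⟩ : HasMatch G (x :: w₁) i)
    exact Relation.ReflTransGen.head hw' (ih w' (by omega))

theorem matchProb_pos {μ : PMF V} {π : PMF (Buffer V)} (hμ : ∀ i, i ∈ μ.support)
    (h : DiscreteChain.IsStationary (Φ.step μ) π) (h0 : π [] ≠ 0) {i j : V} (hij : G.Adj i j) :
    0 < Φ.matchProb π i j := by
  refine ENNReal.toReal_pos ?_ (PMF.apply_ne_top _ _)
  have h1 : π [(j, 0)] ≠ 0 := by
    refine h.apply_ne_zero h0 ((PMF.mem_support_iff _ _).1 ?_)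
    rw [step_eq_bind, PMF.mem_support_bind_iff]
    refine ⟨j, hμ j, ?_⟩
    rw [arrive, if_neg (by simp [HasMatch])]
    simp [grow]
  rw [← PMF.mem_support_iff, PMF.mem_support_bind_iff]
  refine ⟨[(j, 0)], h1, ?_⟩
  have hm : HasMatch G [(j, 0)] i := ⟨(j, 0), by simp, hij⟩
  obtain ⟨k, hk⟩ := (Φ.pick [(j, 0)] i).support_nonempty
  obtain ⟨x, hx, -⟩ := Φ.compatible _ i hm k hk
  rw [matchedClass, if_pos hm, PMF.mem_support_map_iff]
  refine ⟨k, hk, ?_⟩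
  obtain rfl : x = (j, 0) := by simpa using List.mem_of_getElem? hx
  rw [hx, Option.map_some]

theorem matchProb_of_not_adj {i j : V} (hij : ¬ G.Adj i j) (π : PMF (Buffer V)) :
    Φ.matchProb π i j = 0 := by
  rw [matchProb, (PMF.apply_eq_zero_iff _ _).2, ENNReal.toReal_zero]
  rw [PMF.mem_support_bind_iff]
  rintro ⟨w, -, hw⟩
  by_cases h : HasMatch G w i
  · rw [matchedClass, if_pos h, PMF.mem_support_map_iff] at hw
    obtain ⟨k, hk, hkj⟩ := hw
    obtain ⟨x, hx, hadj⟩ := Φ.compatible _ i h k hk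
    rw [hx, Option.map_some, Option.some_inj] at hkj
    exact hij (hkj ▸ hadj)
  · simp [matchedClass, if_neg h] at hw

/-- The diagonal factor 2 makes up for the indicator in `matchingRate`, leaving one formula, visibly
symmetric, for loops and other edges. -/
theorem rateWeights_eq (μ : PMF V) (π : PMF (Buffer V)) (i j : V) :
    Φ.rateWeights μ π i j =
      (μ i).toReal * Φ.matchProb π i j + (μ j).toReal * Φ.matchProb π j i := by
  by_cases h : i = j
  · subst h
    simp only [rateWeights, matchingRate, if_true, ne_eq, not_true_eq_false, if_false]
    ring
  · simp [rateWeights, matchingRate, h]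

theorem isWeights_rateWeights {μ : PMF V} {π : PMF (Buffer V)} (hμ : ∀ i, i ∈ μ.support)
    (h : DiscreteChain.IsStationary (Φ.step μ) π) (h0 : π [] ≠ 0) :
    G.IsWeights (Φ.rateWeights μ π) := by
  have hpos : ∀ i, 0 < (μ i).toReal := fun i =>
    ENNReal.toReal_pos ((PMF.mem_support_iff _ _).1 (hμ i)) (μ.apply_ne_top i)
  refine fun i j hij => ⟨?_, ?_⟩
  · rw [rateWeights_eq, rateWeights_eq, add_comm]
  · rw [rateWeights_eq]
    exact add_pos (mul_pos (hpos i) (Φ.matchProb_pos hμ h h0 hij))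
      (mul_pos (hpos j) (Φ.matchProb_pos hμ h h0 (G.symm hij)))

theorem weightedMeasure_rateWeights [Fintype V] {μ : PMF V} {π : PMF (Buffer V)}
    (h : DiscreteChain.IsStationary (Φ.step μ) π) (i : V) :
    (μ i).toReal = G.weightedMeasure (Φ.rateWeights μ π) i := by
  classical
  have hsum : G.weightedMeasure (Φ.rateWeights μ π) i = ∑ j, Φ.rateWeights μ π i j := by
    refine Finset.sum_subset (Finset.subset_univ _) fun j _ hj => ?_
    have hij : ¬ G.Adj i j := by simpa using hj
    rw [rateWeights_eq, Φ.matchProb_of_not_adj hij,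
      Φ.matchProb_of_not_adj fun hji => hij (G.symm hji)]
    simp
  have h1 : (μ i).toReal * ((π.bind fun w => Φ.matchedClass w i) none).toReal =
      ∑ j, (μ j).toReal * Φ.matchProb π j i := by
    have := congrArg ENNReal.toReal (Φ.mul_bind_matchedClass_none h i)
    rw [tsum_fintype, ENNReal.toReal_sum fun j _ =>
      ENNReal.mul_ne_top (PMF.apply_ne_top _ _) (PMF.apply_ne_top _ _)] at this
    simpa only [ENNReal.toReal_mul, matchProb] using this
  -- An arriving `i`-item is either stored or matched with exactly one class.
  have h2 : ((π.bind fun w => Φ.matchedClass w i) none).toReal + ∑ j, Φ.matchProb π i j = 1 := by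
    have := PMF.sum_toReal (π.bind fun w => Φ.matchedClass w i)
    rwa [Fintype.sum_option] at this
  simp only [hsum, rateWeights_eq]
  rw [Finset.sum_add_distrib, ← h1, ← Finset.mul_sum, ← mul_add, add_comm, h2, mul_one]

end AdmissiblePolicy

theorem mainTheorem6 {V : Type*} [Fintype V] [Nontrivial V] (G : Multigraph V)
    (hG : G.Connected) (Φ : AdmissiblePolicy G) :
    Φ.stab ⊆ G.weightedProbabilities ∧
    G.weightedProbabilities = G.unitWeightedMeasures ∧
    ∀ μ ∈ Φ.stab, ∃ π : PMF (Buffer V),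
      DiscreteChain.IsStationary (Φ.step μ) π ∧
      (∀ π' : PMF (Buffer V), DiscreteChain.IsStationary (Φ.step μ) π' → π' = π) ∧
      G.IsWeights (Φ.rateWeights μ π) ∧
      ∀ i : V, (μ i).toReal = G.normWeightedMeasure (Φ.rateWeights μ π) i := by
  have main : ∀ μ ∈ Φ.stab, ∃ π : PMF (Buffer V),
      DiscreteChain.IsStationary (Φ.step μ) π ∧
      (∀ π' : PMF (Buffer V), DiscreteChain.IsStationary (Φ.step μ) π' → π' = π) ∧
      G.IsWeights (Φ.rateWeights μ π) ∧
      ∀ i : V, (μ i).toReal = G.normWeightedMeasure (Φ.rateWeights μ π) i := by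
    rintro μ ⟨hμ, hrec⟩
    have hfin := hrec [] Relation.ReflTransGen.refl
    obtain ⟨π, hπ, h0⟩ := DiscreteChain.exists_isStationary hfin
    exact ⟨π, hπ, fun π' hπ' => hπ.unique hπ' hfin (Φ.reaches_nil hG hμ),
      Φ.isWeights_rateWeights hμ hπ h0,
      Multigraph.normWeightedMeasure_eq_of_forall_eq (Φ.weightedMeasure_rateWeights hπ)⟩
  refine ⟨fun μ hμ => ?_, G.weightedProbabilities_eq_unitWeightedMeasures, main⟩
  obtain ⟨π, -, -, hw, h⟩ := main μ hμ
  exact ⟨_, hw, h⟩
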